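/- Fix $p$ and integers $r_1,\dots,r_p\ge 1$, and put $d_i=r_i-1$. Let $X_1,\dots,X_p$ be factors, $X_i$ with levels $1,\dots,r_i$, and code a level $x_i$ of $X_i$ by the vector $\mathbf{x}_i\in\{0,1\}^{d_i}$ of the indicators of the levels $2,\dots,r_i$. A parameter $\phi$ consists of intercepts $\beta_{j\ell 0}\in\mathbb{R}$ and coefficient vectors $\beta_{j\ell i}\in\mathbb{R}^{d_i}$ ($1\le i,j\le p$, $1\le\ell\le r_j$); write $\beta_{j\cdot i}=(\beta_{j1i},\dots,\beta_{jr_ji})$. The graph $\mathcal{G}_\phi$ on $\{1,\dots,p\}$ has the edge $i\to j$ if and only if $\beta_{j\cdot i}\ne 0$. The parameter space $\Omega$ is the set of all $\phi$ such that $\mathcal{G}_\phi$ has no directed cycle, $\beta_{j10}=0$ for all $j$, and $\sum_{\ell=1}^{r_j}\beta_{j\ell i}=0$ for all $i,j$. For a state $x=(x_1,\dots,x_p)$ let $$p(x\mid\phi)=\prod_{j=1}^p\frac{\exp\big(\beta_{jx_j0}+\sum_i\mathbf{x}_i^T\beta_{jx_ji}\big)}{\sum_{m=1}^{r_j}\exp\big(\beta_{jm0}+\sum_i\mathbf{x}_i^T\beta_{jmi}\big)},$$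 and let $\phi_{[k]}$ be obtained from $\phi$ by setting $\beta_{k\cdot i}=0$ for $i=1,\dots,p$ (the intercepts are kept). Call $\phi\in\Omega$ natural if, for all $i,j$ such that $\mathcal{G}_\phi$ contains a directed path from $i$ to $j$, the variables $X_i$ and $X_j$ are not independent under the distribution $p(\cdot\mid\phi_{[i]})$. Let $\phi^*\in\Omega$ be fixed (not depending on $n$) and natural. For each $n$, let the data consist of blocks $\mathcal{X}^1,\dots,\mathcal{X}^p$ with $n_1,\dots,n_p$ rows, $n_1+\dots+n_p=n$, where the rows $\mathcal{X}^k_1,\dots,\mathcal{X}^k_{n_k}$ of $\mathcal{X}^k$ are i.i.d. with probability mass function $p(\cdot\mid\phi^*_{[k]})$. With possibly random weights $\tau_{ji}=\tau_{ji}^{(n)}$ and tuning parameters $\lambda_n$, let $$R(\phi)=\sum_{k=1}^p\sum_{h=1}^{n_k}\log p(\mathcal{X}^k_h\mid\phi_{[k]})-\lambda_n\sum_{j=1}^p\sum_{i=1}^p\tau_{ji}\|\beta_{j\cdot i}\|_2 .$$ Assume that $\tau_{ji}=O_p(1)$ for all $i,j$, that $\lambda_n/\sqrt n\to 0$, and that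 $n_k/n\to\alpha_k>0$ for $k=1,\dots,p$. Then there are $\Omega$-valued $\hat\phi=\hat\phi_n$ such that $\hat\phi$ is a global maximizer of $R$ over $\Omega$ whenever there is one, which is the case with probability tending to one as $n\to\infty$, and $\|\hat\phi-\phi^*\|_2=O_p(n^{-1/2})$. -/

import Mathlib

open MeasureTheory ProbabilityTheory Filter Topology

noncomputable section

namespace DiscreteBN

/-- A joint state of `p` factors, the `i`-th of which has `r i = d i + 1` levels. -/
abbrev State {p : ℕ} (d : Fin p → ℕ) : Type := ∀ i : Fin p, Fin (d i + 1)

/-- Index set of the parameter vector: node `j`, level `ℓ` of `X_j`, and then either the intercept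
(`none`) or the dummy variable number `m` of the predictor `X_i` (`some ⟨i, m⟩`). -/
abbrev Idx {p : ℕ} (d : Fin p → ℕ) : Type :=
  Σ j : Fin p, Fin (d j + 1) × Option (Σ i : Fin p, Fin (d i))

/-- The vector of all parameters, with the Euclidean norm. -/
abbrev Param {p : ℕ} (d : Fin p → ℕ) : Type := EuclideanSpace ℝ (Idx d)

variable {p : ℕ} {d : Fin p → ℕ}

/-- The intercept `β_{jℓ0}`. -/
def intercept (φ : Param d) (j : Fin p) (l : Fin (d j + 1)) : ℝ := φ ⟨j, l, none⟩

/-- The `m`-th component of the coefficient vector `β_{jℓi} ∈ ℝ^{d_i}`. -/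
def coef (φ : Param d) (j i : Fin p) (l : Fin (d j + 1)) (m : Fin (d i)) : ℝ :=
  φ ⟨j, l, some ⟨i, m⟩⟩

/-- The group `β_{j·i} ∈ ℝ^{r_j d_i}`: the influence of `X_i` on `X_j`. -/
def group (φ : Param d) (j i : Fin p) : EuclideanSpace ℝ (Fin (d j + 1) × Fin (d i)) :=
  WithLp.toLp 2 fun q => coef φ j i q.1 q.2

/-- The dummy coding of a level of a factor with `e + 1` levels by `e` indicators; the first level
is the one coded by the zero vector. -/
def dummy {e : ℕ} (a : Fin (e + 1)) (m : Fin e) : ℝ := if a = m.succ then 1 else 0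

/-- The linear predictor `β_{jℓ0} + ∑ i, x_iᵀ β_{jℓi}`. -/
def linPred (φ : Param d) (j : Fin p) (l : Fin (d j + 1)) (x : State d) : ℝ :=
  intercept φ j l + ∑ i : Fin p, ∑ m : Fin (d i), dummy (x i) m * coef φ j i l m

/-- The multi-logit conditional probability that `X_j = ℓ`. -/
def condProb (φ : Param d) (j : Fin p) (l : Fin (d j + 1)) (x : State d) : ℝ :=
  Real.exp (linPred φ j l x) / ∑ m : Fin (d j + 1), Real.exp (linPred φ j m x)

/-- The joint probability mass function `p(x | φ) = ∏ j, p(x_j | Π_j)`. -/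
def jointProb (φ : Param d) (x : State d) : ℝ := ∏ j : Fin p, condProb φ j (x j) x

/-- The law on the joint states with probability mass function `p(· | φ)`. -/
def jointLaw (φ : Param d) : Measure (State d) :=
  ∑ x : State d, ENNReal.ofReal (jointProb φ x) • Measure.dirac x

/-- `i → j` is an edge of the graph induced by `φ`, that is, `β_{j·i} ≠ 0`. -/
def Edge (φ : Param d) (i j : Fin p) : Prop := group φ j i ≠ 0

/-- `X_i` is an ancestor of `X_j`: there is a (nonempty) directed path from `i` to `j`. -/
def Ancestor (φ : Param d) : Fin p → Fin p → Prop := Relation.TransGen (Edge φ)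

/-- The graph induced by `φ` has no directed cycle. -/
def Acyclic (φ : Param d) : Prop := ∀ i : Fin p, ¬ Ancestor φ i i

variable (d) in
/-- The parameter space: acyclic parameters whose first intercepts vanish and whose coefficient
vectors sum to zero over the levels of the response. -/
def paramSpace : Set (Param d) :=
  {φ | Acyclic φ ∧ (∀ j : Fin p, intercept φ j 0 = 0) ∧
    ∀ (j i : Fin p) (m : Fin (d i)), ∑ l : Fin (d j + 1), coef φ j i l m = 0}

/-- `φ_[k]`: all coefficient groups `β_{k·i}` are set to zero, intercepts are kept. -/
def intervene (k : Fin p) (φ : Param d) : Param d :=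
  WithLp.toLp 2 fun q => if q.1 = k ∧ q.2.2 ≠ none then 0 else φ q

/-- Natural parameters: if `X_i` is an ancestor of `X_j`, then `X_i` and `X_j` are dependent under
the joint distribution given by `φ_[i]`. -/
def IsNatural (φ : Param d) : Prop :=
  ∀ i j : Fin p, Ancestor φ i j →
    ¬ IndepFun (fun x : State d => x i) (fun x : State d => x j) (jointLaw (intervene i φ))

/-- The log-likelihood `∑ k, ∑ h, log p(𝒳^k_h | φ_[k])` of data given in `p` blocks, the `k`-th
block having `N k` rows. -/
def logLik {N : Fin p → ℕ} (data : ∀ k : Fin p, Fin (N k) → State d) (φ : Param d) : ℝ :=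
  ∑ k : Fin p, ∑ h : Fin (N k), Real.log (jointProb (intervene k φ) (data k h))

/-- The penalized log-likelihood, with weight `τ j i` on the group `β_{j·i}`. -/
def penLogLik {N : Fin p → ℕ} (data : ∀ k : Fin p, Fin (N k) → State d) (lam : ℝ)
    (τ : Fin p → Fin p → ℝ) (φ : Param d) : ℝ :=
  logLik data φ - lam * ∑ j : Fin p, ∑ i : Fin p, τ j i * ‖group φ j i‖

/-- `φ` is a global maximizer of `f` over the parameter space. -/
def IsGlobalMaximizer (f : Param d → ℝ) (φ : Param d) : Prop :=
  φ ∈ paramSpace d ∧ IsMaxOn f (paramSpace d) φ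

/-- `Z n = O_p(a n)`. (For events that are not measurable, `μ` is the outer measure, so that the
notion is the strong one.) -/
def IsBigOInProb {S : Type*} [MeasurableSpace S] (μ : Measure S) (Z : ℕ → S → ℝ) (a : ℕ → ℝ) :
    Prop :=
  ∀ ε : ℝ, 0 < ε → ∃ C : ℝ, ∀ᶠ n in atTop, μ {ω | C * a n < |Z n ω|} ≤ ENNReal.ofReal ε

end DiscreteBN

end

namespace DiscreteBN

variable {p : ℕ} {d : Fin p → ℕ}

/-! ### Elementary facts on the model -/

/-! Write ψ for the true parameter, and let ε be the largest absolute log-likelihood ratio of φ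
against ψ over all interventions and states. Everything is measured in ε, so neither a separate
consistency step nor a Taylor expansion is needed.

Identifiability with a linear rate (`IsNatural.exists_norm_sub_le`): ‖φ - ψ‖ ≤ C ε on the whole
parameter space. Take a source s of the graph of φ. If s is also a source for ψ, intervening on s
changes neither law. Comparison with the other interventions isolates the effect of the parents on
each node, and then intercepts and coefficients (`norm_sub_le_of_common_source`). Otherwise ψ has an
edge i → s, and naturalness makes X_i and X_s dependent under ψ_[i]. Under φ_[i] both are sources,
hence independent, so ε stays above a constant; since ‖φ‖ grows at most linearly in ε, the bound
holds again.

The gain of the criterion from ψ to φ (`exists_penLogLik_sub_le`) is at most -c n ε min(ε, 1) from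
the Kullback–Leibler divergence, plus O(√n) ε from the centred counts and the penalty, outside an
event of small probability. A parameter at least as good as ψ therefore has ε = O(n^{-1/2}). Such
parameters lie in a compact part of the closed parameter space, which gives existence of a maximizer
together with the rate. -/

theorem group_eq_zero_iff {φ : Param d} {j i : Fin p} :
    group φ j i = 0 ↔ ∀ l m, coef φ j i l m = 0 := by
  constructor
  · intro h l m
    have := congrArg (fun v : EuclideanSpace ℝ (Fin (d j + 1) × Fin (d i)) => v (l, m)) h
    simpa [group] using this
  · intro h
    ext q
    simpa [group] using h q.1 q.2

theorem not_edge_iff {φ : Param d} {i j : Fin p} :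
    ¬ Edge φ i j ↔ ∀ l m, coef φ j i l m = 0 := by
  rw [Edge, not_not, group_eq_zero_iff]

theorem coef_sub (φ ψ : Param d) (j i : Fin p) (l : Fin (d j + 1)) (m : Fin (d i)) :
    coef (φ - ψ) j i l m = coef φ j i l m - coef ψ j i l m := rfl

theorem intercept_sub (φ ψ : Param d) (j : Fin p) (l : Fin (d j + 1)) :
    intercept (φ - ψ) j l = intercept φ j l - intercept ψ j l := rfl

theorem linPred_sub (φ ψ : Param d) (j : Fin p) (l : Fin (d j + 1)) (x : State d) :
    linPred (φ - ψ) j l x = linPred φ j l x - linPred ψ j l x := by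
  simp only [linPred, coef_sub, intercept_sub, mul_sub, Finset.sum_sub_distrib]
  ring

theorem group_sub (φ ψ : Param d) (j i : Fin p) : group (φ - ψ) j i = group φ j i - group ψ j i := by
  ext q
  rfl

theorem intercept_intervene (k : Fin p) (φ : Param d) (j : Fin p) (l : Fin (d j + 1)) :
    intercept (intervene k φ) j l = intercept φ j l := by
  simp [intercept, intervene]

theorem coef_intervene (k : Fin p) (φ : Param d) (j i : Fin p) (l : Fin (d j + 1))
    (m : Fin (d i)) : coef (intervene k φ) j i l m = if j = k then 0 else coef φ j i l m := by
  simp [coef, intervene]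

theorem linPred_intervene_of_ne {k j : Fin p} (h : j ≠ k) (φ : Param d) (l : Fin (d j + 1))
    (x : State d) : linPred (intervene k φ) j l x = linPred φ j l x := by
  simp [linPred, intercept_intervene, coef_intervene, h]

theorem linPred_intervene_self (k : Fin p) (φ : Param d) (l : Fin (d k + 1)) (x : State d) :
    linPred (intervene k φ) k l x = intercept φ k l := by
  simp [linPred, intercept_intervene, coef_intervene]

theorem condProb_intervene_of_ne {k j : Fin p} (h : j ≠ k) (φ : Param d) (l : Fin (d j + 1))
    (x : State d) : condProb (intervene k φ) j l x = condProb φ j l x := by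
  simp only [condProb, linPred_intervene_of_ne h]

theorem sum_exp_linPred_pos (φ : Param d) (j : Fin p) (x : State d) :
    0 < ∑ m : Fin (d j + 1), Real.exp (linPred φ j m x) :=
  Finset.sum_pos (fun _ _ => Real.exp_pos _) Finset.univ_nonempty

theorem condProb_pos (φ : Param d) (j : Fin p) (l : Fin (d j + 1)) (x : State d) :
    0 < condProb φ j l x :=
  div_pos (Real.exp_pos _) (sum_exp_linPred_pos φ j x)

theorem sum_condProb (φ : Param d) (j : Fin p) (x : State d) :
    ∑ l, condProb φ j l x = 1 := by
  simp only [condProb, ← Finset.sum_div]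
  exact div_self (sum_exp_linPred_pos φ j x).ne'

theorem condProb_le_one (φ : Param d) (j : Fin p) (l : Fin (d j + 1)) (x : State d) :
    condProb φ j l x ≤ 1 := by
  rw [← sum_condProb φ j x]
  exact Finset.single_le_sum (f := fun l => condProb φ j l x)
    (fun l _ => (condProb_pos φ j l x).le) (Finset.mem_univ l)

theorem jointProb_pos (φ : Param d) (x : State d) : 0 < jointProb φ x :=
  Finset.prod_pos fun j _ => condProb_pos φ j _ x

theorem jointProb_le_one (φ : Param d) (x : State d) : jointProb φ x ≤ 1 :=
  Finset.prod_le_one (fun j _ => (condProb_pos φ j _ x).le) fun j _ => condProb_le_one φ j _ x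

theorem log_condProb_nonpos (φ : Param d) (j : Fin p) (l : Fin (d j + 1)) (x : State d) :
    Real.log (condProb φ j l x) ≤ 0 :=
  Real.log_nonpos (condProb_pos φ j l x).le (condProb_le_one φ j l x)

theorem log_jointProb (φ : Param d) (x : State d) :
    Real.log (jointProb φ x) = ∑ j, Real.log (condProb φ j (x j) x) :=
  Real.log_prod fun j _ => (condProb_pos φ j _ x).ne'

theorem log_condProb (φ : Param d) (j : Fin p) (l : Fin (d j + 1)) (x : State d) :
    Real.log (condProb φ j l x)
      = linPred φ j l x - Real.log (∑ m : Fin (d j + 1), Real.exp (linPred φ j m x)) := by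
  rw [condProb, Real.log_div (Real.exp_pos _).ne' (sum_exp_linPred_pos φ j x).ne', Real.log_exp]

theorem log_condProb_sub_log_condProb (φ : Param d) (j : Fin p) (l l' : Fin (d j + 1))
    (x : State d) :
    Real.log (condProb φ j l x) - Real.log (condProb φ j l' x)
      = linPred φ j l x - linPred φ j l' x := by
  rw [log_condProb, log_condProb]
  ring

/-- The linear predictor of `X_j` only depends on the parents of `X_j`. -/
theorem linPred_congr {φ : Param d} {j : Fin p} (l : Fin (d j + 1)) {x y : State d}
    (h : ∀ i, Edge φ i j → x i = y i) : linPred φ j l x = linPred φ j l y := by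
  unfold linPred
  congr 1
  refine Finset.sum_congr rfl fun i _ => ?_
  by_cases e : Edge φ i j
  · rw [h i e]
  · simp [not_edge_iff.1 e]

theorem condProb_congr {φ : Param d} {j : Fin p} (l : Fin (d j + 1)) {x y : State d}
    (h : ∀ i, Edge φ i j → x i = y i) : condProb φ j l x = condProb φ j l y := by
  simp only [condProb, linPred_congr _ h]

theorem condProb_update_of_not_edge {φ : Param d} {i j : Fin p} (h : ¬ Edge φ i j)
    (l : Fin (d j + 1)) (x : State d) (a : Fin (d i + 1)) :
    condProb φ j l (Function.update x i a) = condProb φ j l x := by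
  refine condProb_congr l fun k hk => ?_
  rw [Function.update_of_ne]
  rintro rfl
  exact h hk

theorem Acyclic.not_edge_self {φ : Param d} (h : Acyclic φ) (j : Fin p) : ¬ Edge φ j j :=
  fun e => h j (Relation.TransGen.single e)

theorem Edge.of_intervene {φ : Param d} {k i j : Fin p} (h : Edge (intervene k φ) i j) :
    j ≠ k ∧ Edge φ i j := by
  constructor
  · rintro rfl
    exact (not_edge_iff.2 fun l m => by simp [coef_intervene]) h
  · by_contra h'
    refine (not_edge_iff.2 fun l m => ?_) h
    simp [coef_intervene, not_edge_iff.1 h' l m]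

theorem Acyclic.mono {φ ψ : Param d} (h : Acyclic φ) (hE : ∀ i j, Edge ψ i j → Edge φ i j) :
    Acyclic ψ :=
  fun i hi => h i (Relation.TransGen.mono hE _ _ hi)

theorem Acyclic.intervene {φ : Param d} (h : Acyclic φ) (k : Fin p) : Acyclic (intervene k φ) :=
  h.mono fun _ _ e => e.of_intervene.2

theorem Acyclic.wellFounded {φ : Param d} (h : Acyclic φ) : WellFounded (Edge φ) := by
  have : Std.Irrefl (Ancestor φ) := ⟨h⟩
  have : IsTrans (Fin p) (Ancestor φ) := ⟨fun _ _ _ => Relation.TransGen.trans⟩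
  exact Subrelation.wf (fun e => Relation.TransGen.single e)
    (Finite.wellFounded_of_trans_of_irrefl (Ancestor φ))

theorem Acyclic.exists_source {φ : Param d} (h : Acyclic φ) (i₀ : Fin p) :
    ∃ s, ∀ i, ¬ Edge φ i s := by
  obtain ⟨s, -, hs⟩ := h.wellFounded.has_min Set.univ ⟨i₀, trivial⟩
  exact ⟨s, fun i => hs i trivial⟩

/-- The log-likelihood ratio for the effect of the parents on `X_k`. -/
noncomputable def parentEffect (φ : Param d) (k : Fin p) (x : State d) : ℝ :=
  Real.log (condProb φ k (x k) x) - Real.log (condProb (intervene k φ) k (x k) x)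

theorem parentEffect_of_source {φ : Param d} {s : Fin p} (hs : ∀ i, ¬ Edge φ i s) (x : State d) :
    parentEffect φ s x = 0 := by
  have : ∀ l, linPred φ s l x = linPred (intervene s φ) s l x := fun l => by
    rw [linPred_intervene_self]
    simp [linPred, not_edge_iff.1 (hs _)]
  simp [parentEffect, condProb, this]

/-- Only the factor of node k changes, so different interventions are comparable through parent
effects alone. -/
theorem log_jointProb_intervene (φ : Param d) (k : Fin p) (x : State d) :
    Real.log (jointProb (intervene k φ) x)
      = ∑ j, Real.log (condProb φ j (x j) x) - parentEffect φ k x := by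
  rw [log_jointProb, ← Finset.add_sum_erase _ _ (Finset.mem_univ k),
    ← Finset.add_sum_erase _ (fun j => Real.log (condProb φ j (x j) x)) (Finset.mem_univ k),
    Finset.sum_congr rfl fun j hj => by rw [condProb_intervene_of_ne (Finset.ne_of_mem_erase hj)],
    parentEffect]
  ring

/-! ### Norm estimates -/

theorem norm_le_sum_abs {ι : Type*} [Fintype ι] (x : EuclideanSpace ℝ ι) : ‖x‖ ≤ ∑ i, |x i| := by
  rw [EuclideanSpace.norm_eq]
  refine Real.sqrt_le_iff.2 ⟨Finset.sum_nonneg fun _ _ => abs_nonneg _, ?_⟩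
  simp only [Real.norm_eq_abs]
  exact Finset.sum_sq_le_sq_sum_of_nonneg fun _ _ => abs_nonneg _

theorem norm_group_le (φ : Param d) (j i : Fin p) : ‖group φ j i‖ ≤ ‖φ‖ := by
  rw [EuclideanSpace.norm_eq, EuclideanSpace.norm_eq]
  refine Real.sqrt_le_sqrt ?_
  have hinj : Function.Injective
      (fun q : Fin (d j + 1) × Fin (d i) => (⟨j, q.1, some ⟨i, q.2⟩⟩ : Idx d)) := by
    rintro ⟨a, b⟩ ⟨a', b'⟩ h
    simpa using h
  calc ∑ q, ‖group φ j i q‖ ^ 2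
      = ∑ q : Fin (d j + 1) × Fin (d i), ‖φ ⟨j, q.1, some ⟨i, q.2⟩⟩‖ ^ 2 := rfl
    _ = ∑ y ∈ Finset.univ.map ⟨_, hinj⟩, ‖φ y‖ ^ 2 := by rw [Finset.sum_map]; rfl
    _ ≤ ∑ y, ‖φ y‖ ^ 2 :=
        Finset.sum_le_sum_of_subset_of_nonneg (Finset.subset_univ _) fun _ _ _ => sq_nonneg _

theorem dummy_zero {e : ℕ} (m : Fin e) : dummy (0 : Fin (e + 1)) m = 0 := by
  simp [dummy, (Fin.succ_ne_zero m).symm]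

theorem linPred_update_zero (φ : Param d) (j i : Fin p) (l : Fin (d j + 1)) (m : Fin (d i)) :
    linPred φ j l (Function.update 0 i m.succ) = intercept φ j l + coef φ j i l m := by
  unfold linPred
  congr 1
  rw [Finset.sum_eq_single i]
  · rw [Finset.sum_eq_single m]
    · simp [dummy]
    · intro b _ hb
      simp [dummy, hb.symm]
    · simp
  · intro b _ hb
    simp [Function.update_of_ne hb, dummy_zero]
  · simp

/-- Under the identifiability constraints a parameter is controlled by its intercepts and by the
contrasts of its linear predictors. -/
theorem norm_le_of_contrasts {u : Param d} (h0 : ∀ j, intercept u j 0 = 0)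
    (hsum : ∀ (j i : Fin p) (m : Fin (d i)), ∑ l, coef u j i l m = 0) {ε : ℝ} (hε : 0 ≤ ε)
    (hint : ∀ j l, |intercept u j l| ≤ ε)
    (hlin : ∀ j l x, |linPred u j l x - linPred u j 0 x| ≤ ε) :
    ‖u‖ ≤ Fintype.card (Idx d) * (4 * ε) := by
  have hdiff : ∀ (j i : Fin p) (l : Fin (d j + 1)) (m : Fin (d i)),
      |coef u j i l m - coef u j i 0 m| ≤ 2 * ε := by
    intro j i l m
    have h1 := hlin j l (Function.update 0 i m.succ)
    rw [linPred_update_zero, linPred_update_zero, h0] at h1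
    have h2 := hint j l
    rw [abs_le] at h1 h2 ⊢
    constructor <;> linarith [h1.1, h1.2, h2.1, h2.2]
  have hcoef : ∀ (j i : Fin p) (l : Fin (d j + 1)) (m : Fin (d i)),
      |coef u j i l m| ≤ 4 * ε := by
    -- The differences between levels determine each coefficient, because the coefficients average
    -- to zero over the levels.
    intro j i l m
    have h1 : ((d j : ℝ) + 1) * coef u j i l m
        = ∑ l', (coef u j i l m - coef u j i l' m) := by
      rw [Finset.sum_sub_distrib, hsum]
      simp
    have h2 : |((d j : ℝ) + 1) * coef u j i l m| ≤ ((d j : ℝ) + 1) * (4 * ε) := by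
      rw [h1]
      refine (Finset.abs_sum_le_sum_abs _ _).trans ?_
      refine (Finset.sum_le_card_nsmul _ _ (4 * ε) fun l' _ => ?_).trans (by simp)
      have h3 := hdiff j i l m
      have h4 := hdiff j i l' m
      rw [abs_le] at h3 h4 ⊢
      constructor <;> linarith [h3.1, h3.2, h4.1, h4.2]
    have hpos : (0 : ℝ) < (d j : ℝ) + 1 := by positivity
    rw [abs_mul, abs_of_pos hpos] at h2
    exact le_of_mul_le_mul_left h2 hpos
  refine (norm_le_sum_abs u).trans ?_
  refine (Finset.sum_le_card_nsmul _ _ (4 * ε) ?_).trans (by simp)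
  rintro ⟨j, l, _ | ⟨i, m⟩⟩ -
  · exact (hint j l).trans (by linarith)
  · exact hcoef j i l m

/-! ### Quantitative identifiability -/

/-- The log-likelihood ratio of `φ` against `ψ` under the intervention on `X_k`. -/
noncomputable def logRatio (φ ψ : Param d) (k : Fin p) (x : State d) : ℝ :=
  Real.log (jointProb (intervene k φ) x) - Real.log (jointProb (intervene k ψ) x)

/-- The log-likelihood of the model in which all effects are removed. -/
noncomputable def logIndepProb (φ : Param d) (x : State d) : ℝ :=
  ∑ j, Real.log (condProb (intervene j φ) j (x j) x)

theorem sum_log_condProb (φ : Param d) (x : State d) :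
    ∑ j, Real.log (condProb φ j (x j) x) = logIndepProb φ x + ∑ j, parentEffect φ j x := by
  simp [logIndepProb, parentEffect]

theorem condProb_intervene_self_congr (φ : Param d) (j : Fin p) (l : Fin (d j + 1))
    (x y : State d) : condProb (intervene j φ) j l x = condProb (intervene j φ) j l y := by
  simp only [condProb, linPred_intervene_self]

theorem logIndepProb_update_sub (φ : Param d) (j : Fin p) (l l' : Fin (d j + 1)) (x : State d) :
    logIndepProb φ (Function.update x j l) - logIndepProb φ (Function.update x j l')
      = intercept φ j l - intercept φ j l' := by
  unfold logIndepProb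
  rw [← Finset.sum_sub_distrib, Finset.sum_eq_single j]
  · rw [Function.update_self, Function.update_self,
      condProb_intervene_self_congr φ j l _ x, condProb_intervene_self_congr φ j l' _ x,
      log_condProb_sub_log_condProb, linPred_intervene_self, linPred_intervene_self]
  · intro k _ hk
    rw [Function.update_of_ne hk, Function.update_of_ne hk,
      condProb_intervene_self_congr φ k _ _ (Function.update x j l'), sub_self]
  · simp

/-- Without a loop at j, the normalizing sums do not depend on the level of X_j, so they cancel
between the levels l and 0. -/
theorem linPred_contrast {φ : Param d} (hφ : φ ∈ paramSpace d) (j : Fin p) (l : Fin (d j + 1))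
    (x : State d) : linPred φ j l x - linPred φ j 0 x
      = parentEffect φ j (Function.update x j l) - parentEffect φ j (Function.update x j 0)
        + intercept φ j l := by
  have h1 : intercept φ j l = intercept φ j l - intercept φ j 0 := by rw [hφ.2.1 j, sub_zero]
  rw [h1, ← linPred_intervene_self j φ l x, ← linPred_intervene_self j φ 0 x,
    ← log_condProb_sub_log_condProb, ← log_condProb_sub_log_condProb]
  simp only [parentEffect, Function.update_self,
    condProb_update_of_not_edge (hφ.1.not_edge_self j),
    condProb_update_of_not_edge ((hφ.1.intervene j).not_edge_self j)]
  ring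

/-- The intervention on s shows the unintervened log-ratio T, and the one on k shows T minus the
difference G k of parent effects. Removing all G k from T leaves the ratio of the models without
edges, which contains only intercepts; the G k then give the contrasts of the linear predictors. -/
theorem norm_sub_le_of_common_source {φ ψ : Param d} (hφ : φ ∈ paramSpace d)
    (hψ : ψ ∈ paramSpace d) {s : Fin p} (hs : ∀ i, ¬ Edge φ i s) (hs' : ∀ i, ¬ Edge ψ i s) {ε : ℝ}
    (h : ∀ k x, |logRatio φ ψ k x| ≤ ε) :
    ‖φ - ψ‖ ≤ Fintype.card (Idx d) * (4 * ((4 * p + 6) * ε)) := by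
  have hε : 0 ≤ ε := (abs_nonneg _).trans (h s 0)
  have hp : (0 : ℝ) ≤ p := Nat.cast_nonneg p
  have hpε : 0 ≤ p * ε := mul_nonneg hp hε
  set T : State d → ℝ := fun x =>
    ∑ j, Real.log (condProb φ j (x j) x) - ∑ j, Real.log (condProb ψ j (x j) x) with hT
  set G : Fin p → State d → ℝ := fun k x => parentEffect φ k x - parentEffect ψ k x with hG
  have hTG : ∀ k x, logRatio φ ψ k x = T x - G k x := fun k x => by
    simp only [logRatio, log_jointProb_intervene, hT, hG]
    ring
  have hTb : ∀ x, |T x| ≤ ε := fun x => by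
    have := h s x
    have hG0 : G s x = 0 := by
      simp only [hG, parentEffect_of_source hs, parentEffect_of_source hs', sub_self]
    rwa [hTG, hG0, sub_zero] at this
  have hGb : ∀ k x, |G k x| ≤ 2 * ε := fun k x => by
    have h1 := h k x
    have h2 := hTb x
    rw [hTG] at h1
    rw [abs_le] at h1 h2 ⊢
    constructor <;> linarith [h1.1, h1.2, h2.1, h2.2]
  have hSb : ∀ x, |logIndepProb φ x - logIndepProb ψ x| ≤ (2 * p + 1) * ε := fun x => by
    have h1 : logIndepProb φ x - logIndepProb ψ x = T x - ∑ k, G k x := by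
      simp only [hT, hG, sum_log_condProb, Finset.sum_sub_distrib]
      ring
    have h2 : |∑ k, G k x| ≤ p * (2 * ε) := by
      refine (Finset.abs_sum_le_sum_abs _ _).trans ?_
      exact (Finset.sum_le_card_nsmul _ _ (2 * ε) fun k _ => hGb k x).trans (by simp)
    rw [h1]
    refine (abs_sub _ _).trans ?_
    linarith [hTb x]
  -- Two evaluations of the edge-free ratio cost (2p + 1) ε each; two parent effects add 4 ε below,
  -- whence 4p + 6.
  have hint : ∀ j l, |intercept (φ - ψ) j l| ≤ (4 * p + 2) * ε := fun j l => by
    have e1 := logIndepProb_update_sub φ j l 0 0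
    have e2 := logIndepProb_update_sub ψ j l 0 0
    rw [hφ.2.1] at e1
    rw [hψ.2.1] at e2
    have h1 := hSb (Function.update 0 j l)
    have h2 := hSb (Function.update 0 j 0)
    rw [intercept_sub]
    rw [abs_le] at h1 h2 ⊢
    constructor <;> linarith [h1.1, h1.2, h2.1, h2.2]
  refine norm_le_of_contrasts ?_ ?_ (by positivity) ?_ ?_
  · intro j
    rw [intercept_sub, hφ.2.1, hψ.2.1, sub_zero]
  · intro j i m
    simp only [coef_sub, Finset.sum_sub_distrib, hφ.2.2, hψ.2.2, sub_zero]
  · exact fun j l => (hint j l).trans (by nlinarith)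
  · intro j l x
    have e1 := linPred_contrast hφ j l x
    have e2 := linPred_contrast hψ j l x
    have h1 := hGb j (Function.update x j l)
    have h2 := hGb j (Function.update x j 0)
    have h3 := hint j l
    simp only [hG] at h1 h2
    rw [intercept_sub] at h3
    rw [linPred_sub, linPred_sub]
    rw [abs_le] at h1 h2 h3 ⊢
    constructor <;> linarith [h1.1, h1.2, h2.1, h2.2, h3.1, h3.2]

theorem neg_log_condProb_le (φ : Param d) (j : Fin p) (x : State d) :
    -Real.log (condProb φ j (x j) x) ≤ -Real.log (jointProb φ x) := by
  rw [log_jointProb, neg_le_neg_iff, ← Finset.add_sum_erase _ _ (Finset.mem_univ j)]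
  linarith [Finset.sum_nonpos (s := Finset.univ.erase j)
    fun k _ => log_condProb_nonpos φ k (x k) x]

/-- Resetting X_j to any level does not affect its own conditional law, so the log-probabilities of
all levels lie in [-E, 0]. -/
theorem abs_linPred_contrast_le {φ : Param d} (hφ : Acyclic φ) {E : ℝ}
    (h : ∀ x, -Real.log (jointProb φ x) ≤ E) (j : Fin p) (l : Fin (d j + 1)) (x : State d) :
    |linPred φ j l x - linPred φ j 0 x| ≤ E := by
  have key : ∀ a, -Real.log (condProb φ j a x) ≤ E := fun a => by
    have h1 := (neg_log_condProb_le φ j (Function.update x j a)).trans (h _)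
    rwa [Function.update_self, condProb_update_of_not_edge (hφ.not_edge_self j)] at h1
  rw [← log_condProb_sub_log_condProb, abs_le]
  constructor <;>
    linarith [key l, key 0, log_condProb_nonpos φ j l x, log_condProb_nonpos φ j 0 x]

/-- A parameter whose interventional distributions are bounded below is bounded. -/
theorem norm_le_of_neg_log_jointProb_le {φ : Param d} (hφ : φ ∈ paramSpace d) {E : ℝ}
    (hE : 0 ≤ E) (h : ∀ k x, -Real.log (jointProb (intervene k φ) x) ≤ E) :
    ‖φ‖ ≤ Fintype.card (Idx d) * (4 * E) := by
  refine norm_le_of_contrasts hφ.2.1 hφ.2.2 hE ?_ ?_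
  · intro j l
    have := abs_linPred_contrast_le (hφ.1.intervene j) (h j) j l 0
    rwa [linPred_intervene_self, linPred_intervene_self, hφ.2.1, sub_zero] at this
  · intro j
    -- Intervening on a source leaves the law unchanged, so the bound passes to the law of φ itself.
    obtain ⟨s, hs⟩ := hφ.1.exists_source j
    have hφs : ∀ x, -Real.log (jointProb φ x) ≤ E := fun x => by
      have := h s x
      rwa [log_jointProb_intervene, parentEffect_of_source hs, sub_zero, ← log_jointProb] at this
    exact abs_linPred_contrast_le hφ.1 hφs j

/-! ### Marginalization in directed acyclic graphs -/

section Marginal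

variable {ι : Type*} {β : ι → Type*} [Fintype ι] [DecidableEq ι] [∀ i, Fintype (β i)]

/-- Fubini along coordinate j: equal fibre sums give equal total sums. -/
theorem sum_eq_sum_of_update (j : ι) {f g : (∀ i, β i) → ℝ}
    (h : ∀ x, ∑ l, f (Function.update x j l) = ∑ l, g (Function.update x j l)) :
    ∑ x, f x = ∑ x, g x := by
  have key : ∀ f : (∀ i, β i) → ℝ, ∑ x, f x
      = ∑ y : (∀ i : {i // i ≠ j}, β i), ∑ l, f ((Equiv.piSplitAt j β).symm (l, y)) := fun f => by
    rw [← (Equiv.piSplitAt j β).symm.sum_comp f, Fintype.sum_prod_type_right]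
  rw [key f, key g]
  refine Finset.sum_congr rfl fun y _ => ?_
  rcases isEmpty_or_nonempty (β j) with _ | ⟨⟨l₀⟩⟩
  · simp
  · have hu : ∀ l, (Equiv.piSplitAt j β).symm (l, y)
        = Function.update ((Equiv.piSplitAt j β).symm (l₀, y)) j l := fun l => by
      ext i
      by_cases hi : i = j
      · subst hi
        simp
      · rw [Function.update_of_ne hi, Equiv.piSplitAt_symm_apply, Equiv.piSplitAt_symm_apply,
          dif_neg hi, dif_neg hi]
    rw [Finset.sum_congr rfl fun l _ => congrArg f (hu l),
      Finset.sum_congr rfl fun l _ => congrArg g (hu l)]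
    exact h _

theorem sum_mul_eq_of_update_eq [∀ i, Nonempty (β i)] (i : ι) (g : β i → ℝ)
    {h : (∀ i, β i) → ℝ} (hh : ∀ x a, h (Function.update x i a) = h x) :
    ∑ x, g (x i) * h x = (∑ l, g l) * ∑ x, (Fintype.card (β i) : ℝ)⁻¹ * h x := by
  rw [Finset.mul_sum]
  refine sum_eq_sum_of_update i fun x => ?_
  simp only [hh, Function.update_self, ← Finset.sum_mul, Finset.sum_const, Finset.card_univ,
    nsmul_eq_mul]
  have : (Fintype.card (β i) : ℝ) ≠ 0 := Nat.cast_ne_zero.2 Fintype.card_ne_zero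
  field_simp

/-- Summing out all nodes outside a parent-closed set `A`. -/
theorem sum_mul_prod_eq_marginal [∀ i, Nonempty (β i)] {r : ι → ι → Prop} (hr : WellFounded r)
    {c : ι → (∀ i, β i) → ℝ}
    (hc : ∀ i j, ¬ r i j → i ≠ j → ∀ x a, c j (Function.update x i a) = c j x)
    (hc1 : ∀ j x, ∑ l, c j (Function.update x j l) = 1) {f : (∀ i, β i) → ℝ} (A : Finset ι)
    (hA : ∀ i j, r i j → j ∈ A → i ∈ A)
    (hf : ∀ i, i ∉ A → ∀ x a, f (Function.update x i a) = f x) :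
    ∑ x, f x * ∏ j, c j x
      = ∑ x, f x * ((∏ j ∈ A, c j x) * ∏ j ∈ Aᶜ, (Fintype.card (β j) : ℝ)⁻¹) := by
  -- Sums remain over all states: a node that is summed out has its conditional probability replaced
  -- by the uniform weight, which also sums to one. The induction adds to A a minimal node outside
  -- it, whose parents all lie in A.
  induction hn : Aᶜ.card generalizing A with
  | zero =>
    have hA' : A = Finset.univ := by rwa [Finset.card_eq_zero, Finset.compl_eq_empty_iff] at hn
    simp [hA']
  | succ n ih =>
    obtain ⟨j₀, hj₀⟩ : (Aᶜ).Nonempty := Finset.card_pos.1 (by omega)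
    obtain ⟨j, hj, hmin⟩ := hr.has_min {j | j ∉ A} ⟨j₀, by simpa using hj₀⟩
    have hj : j ∉ A := hj
    have hpar : ∀ i, r i j → i ∈ A := fun i hi => by
      by_contra hiA
      exact hmin i hiA hi
    have hcl : ∀ i k, r i k → k ∈ insert j A → i ∈ insert j A := by
      intro i k hik hk
      rcases Finset.mem_insert.1 hk with rfl | hk
      · exact Finset.mem_insert_of_mem (hpar i hik)
      · exact Finset.mem_insert_of_mem (hA i k hik hk)
    have hcompl : Aᶜ = insert j (insert j A)ᶜ := by
      ext k
      by_cases hk : k = j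
      · simp [hk, hj]
      · simp [hk]
    have hj' : j ∉ (insert j A)ᶜ := by simp
    have hcard : ((insert j A)ᶜ).card = n := by
      rw [hcompl, Finset.card_insert_of_notMem hj'] at hn
      omega
    rw [ih (insert j A) hcl
      (fun i hi => hf i fun h => hi (Finset.mem_insert_of_mem h)) hcard, hcompl]
    refine sum_eq_sum_of_update j fun x => ?_
    have hprod : ∀ a, ∏ k ∈ A, c k (Function.update x j a) = ∏ k ∈ A, c k x := fun a =>
      Finset.prod_congr rfl fun k hk => hc j k (fun h => hj (hA j k h hk))
        (fun h => hj (h ▸ hk)) x a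
    simp only [Finset.prod_insert hj, Finset.prod_insert hj', hprod, hf j hj]
    have hne : (Fintype.card (β j) : ℝ) ≠ 0 := Nat.cast_ne_zero.2 Fintype.card_ne_zero
    rw [← Finset.mul_sum, Finset.sum_const, Finset.card_univ, nsmul_eq_mul, ← Finset.sum_mul,
      ← Finset.sum_mul, hc1]
    field_simp

end Marginal

/-- The expectation of `f` under the distribution with parameter `φ`. -/
noncomputable def expect (φ : Param d) (f : State d → ℝ) : ℝ := ∑ x, f x * jointProb φ x

theorem Acyclic.expect_eq {φ : Param d} (h : Acyclic φ) {f : State d → ℝ} (A : Finset (Fin p))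
    (hA : ∀ i j, Edge φ i j → j ∈ A → i ∈ A)
    (hf : ∀ i, i ∉ A → ∀ x a, f (Function.update x i a) = f x) :
    expect φ f = ∑ x : State d, f x * ((∏ j ∈ A, condProb φ j (x j) x)
      * ∏ j ∈ Aᶜ, (Fintype.card (Fin (d j + 1)) : ℝ)⁻¹) := by
  refine sum_mul_prod_eq_marginal (β := fun i => Fin (d i + 1)) h.wellFounded
    (c := fun j x => condProb φ j (x j) x) ?_ ?_ A hA hf
  · intro i j hij hne x a
    rw [Function.update_of_ne hne.symm, condProb_update_of_not_edge hij]
  · intro j x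
    simp only [Function.update_self, condProb_update_of_not_edge (h.not_edge_self j)]
    exact sum_condProb φ j x

theorem Acyclic.sum_jointProb {φ : Param d} (h : Acyclic φ) : ∑ x, jointProb φ x = 1 := by
  have h1 := h.expect_eq (f := fun _ => 1) ∅ (by simp) (by simp)
  have h2 : (Fintype.card (State d) : ℝ) = ∏ j, (Fintype.card (Fin (d j + 1)) : ℝ) := by
    rw [Fintype.card_pi, Nat.cast_prod]
  simp only [expect, one_mul, Finset.prod_empty, Finset.compl_empty, Finset.sum_const,
    Finset.card_univ, nsmul_eq_mul, h2] at h1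
  rw [h1, ← Finset.prod_mul_distrib]
  refine Finset.prod_eq_one fun j _ => mul_inv_cancel₀ ?_
  exact Nat.cast_ne_zero.2 Fintype.card_ne_zero

/-- Two distinct sources are independent. -/
theorem Acyclic.expect_mul_of_sources {φ : Param d} (h : Acyclic φ) {i s : Fin p} (his : i ≠ s)
    (hi : ∀ k, ¬ Edge φ k i) (hs : ∀ k, ¬ Edge φ k s) (u : Fin (d i + 1) → ℝ)
    (v : Fin (d s + 1) → ℝ) :
    expect φ (fun x => u (x i) * v (x s))
      = expect φ (fun x => u (x i)) * expect φ (fun x => v (x s)) := by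
  -- Any factorization G u * H v suffices: constant test functions give G 1 * H 1 = 1, and G, H need
  -- not be identified as marginals.
  have key : ∃ (G : (Fin (d i + 1) → ℝ) → ℝ) (H : (Fin (d s + 1) → ℝ) → ℝ), ∀ u v,
      expect φ (fun x => u (x i) * v (x s)) = G u * H v := by
    refine ⟨fun u => ∑ l, u l * condProb φ i l 0,
      fun v => ∑ x : State d, (Fintype.card (Fin (d i + 1)) : ℝ)⁻¹ * (v (x s) *
        condProb φ s (x s) 0 * ∏ j ∈ ({i, s} : Finset (Fin p))ᶜ,
          (Fintype.card (Fin (d j + 1)) : ℝ)⁻¹), fun u v => ?_⟩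
    rw [h.expect_eq {i, s}]
    · rw [← sum_mul_eq_of_update_eq (β := fun i => Fin (d i + 1)) i
        (fun l => u l * condProb φ i l 0)]
      · refine Finset.sum_congr rfl fun x _ => ?_
        rw [Finset.prod_pair his, condProb_congr (x := x) (y := 0) (x i) fun k hk => (hi k hk).elim,
          condProb_congr (x := x) (y := 0) (x s) fun k hk => (hs k hk).elim]
        ring
      · intro x a
        rw [Function.update_of_ne his.symm]
    · intro k j hkj hj
      rcases Finset.mem_insert.1 hj with rfl | hj
      · exact (hi k hkj).elim
      · rw [Finset.mem_singleton.1 hj] at hkj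
        exact (hs k hkj).elim
    · intro k hk x a
      simp only [Finset.mem_insert, Finset.mem_singleton, not_or] at hk
      rw [Function.update_of_ne (Ne.symm hk.1), Function.update_of_ne (Ne.symm hk.2)]
  obtain ⟨G, H, hGH⟩ := key
  have h11 := hGH (fun _ => 1) (fun _ => 1)
  have hu1 := hGH u (fun _ => 1)
  have h1v := hGH (fun _ => 1) v
  simp only [mul_one, one_mul] at h11 hu1 h1v
  have hone : expect φ (fun _ => 1) = 1 := by simp [expect, h.sum_jointProb]
  rw [hone] at h11
  rw [hGH, hu1, h1v]
  linear_combination (G u * H v) * h11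

/-! ### Dependence is an open condition -/

theorem jointLaw_apply (φ : Param d) (A : Set (State d)) :
    jointLaw φ A = ENNReal.ofReal (expect φ (A.indicator 1)) := by
  have hA : MeasurableSet A := A.toFinite.measurableSet
  rw [jointLaw, Measure.finsetSum_apply, expect, ENNReal.ofReal_sum_of_nonneg]
  · refine Finset.sum_congr rfl fun x _ => ?_
    by_cases hx : x ∈ A <;> simp [hA, hx]
  · intro x _
    exact mul_nonneg (Set.indicator_nonneg (by simp) x) (jointProb_pos φ x).le

/-- Indicators suffice as test functions; keeping them in [0, 1] makes the perturbation bounds below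
uniform. -/
theorem indepFun_of_expect_mul {φ : Param d} {i j : Fin p}
    (h : ∀ (u : Fin (d i + 1) → ℝ) (v : Fin (d j + 1) → ℝ),
      (∀ a, u a ∈ Set.Icc (0 : ℝ) 1) → (∀ a, v a ∈ Set.Icc (0 : ℝ) 1) →
      expect φ (fun x => u (x i) * v (x j))
        = expect φ (fun x => u (x i)) * expect φ (fun x => v (x j))) :
    IndepFun (fun x : State d => x i) (fun x : State d => x j) (jointLaw φ) := by
  rw [indepFun_iff_measure_inter_preimage_eq_mul]
  intro S T _ _
  rw [jointLaw_apply, jointLaw_apply, jointLaw_apply, ← ENNReal.ofReal_mul]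
  · congr 1
    have hind : ∀ {e : ℕ} (S : Set (Fin (e + 1))) a,
        S.indicator (1 : Fin (e + 1) → ℝ) a ∈ Set.Icc (0 : ℝ) 1 :=
      fun S a => ⟨Set.indicator_nonneg (by simp) a, Set.indicator_le_self' (by simp) a⟩
    have h1 := h (S.indicator 1) (T.indicator 1) (hind S) (hind T)
    convert h1 using 2
    · ext x
      by_cases h1 : x i ∈ S <;> by_cases h2 : x j ∈ T <;> simp [Set.indicator, h1, h2]
    · rfl
    · rfl
  · exact Finset.sum_nonneg fun x _ =>
      mul_nonneg (Set.indicator_nonneg (by simp) x) (jointProb_pos φ x).le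

theorem abs_expect_sub_le {φ ψ : Param d} {ε : ℝ}
    (h : ∀ x, |Real.log (jointProb φ x) - Real.log (jointProb ψ x)| ≤ ε) {f : State d → ℝ}
    (hf : ∀ x, f x ∈ Set.Icc (0 : ℝ) 1) :
    |expect φ f - expect ψ f| ≤ Fintype.card (State d) * (Real.exp ε - 1) := by
  unfold expect
  rw [← Finset.sum_sub_distrib]
  refine (Finset.abs_sum_le_sum_abs _ _).trans ?_
  refine (Finset.sum_le_card_nsmul _ _ (Real.exp ε - 1) fun x _ => ?_).trans (by simp)
  rw [← mul_sub, abs_mul, abs_of_nonneg (hf x).1]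
  refine (mul_le_of_le_one_left (abs_nonneg _) (hf x).2).trans ?_
  have hφ := jointProb_pos φ x
  have hψ := jointProb_pos ψ x
  have hx := abs_le.1 (h x)
  have hε : 0 ≤ ε := (abs_nonneg _).trans (h x)
  have e1 : jointProb φ x ≤ Real.exp ε * jointProb ψ x := by
    rw [← Real.exp_log hφ, ← Real.exp_log hψ, ← Real.exp_add]
    exact Real.exp_le_exp.2 (by linarith)
  have e2 : jointProb ψ x ≤ Real.exp ε * jointProb φ x := by
    rw [← Real.exp_log hφ, ← Real.exp_log hψ, ← Real.exp_add]
    exact Real.exp_le_exp.2 (by linarith)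
  have e3 : 0 ≤ Real.exp ε - 1 := by linarith [Real.one_le_exp hε]
  have e4 := mul_le_of_le_one_right e3 (jointProb_le_one φ x)
  have e5 := mul_le_of_le_one_right e3 (jointProb_le_one ψ x)
  rw [abs_le]
  constructor <;> linarith

theorem expect_mem_Icc {φ : Param d} (hφ : Acyclic φ) {f : State d → ℝ}
    (hf : ∀ x, f x ∈ Set.Icc (0 : ℝ) 1) : expect φ f ∈ Set.Icc (0 : ℝ) 1 := by
  constructor
  · exact Finset.sum_nonneg fun x _ => mul_nonneg (hf x).1 (jointProb_pos φ x).le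
  · rw [← hφ.sum_jointProb]
    exact Finset.sum_le_sum fun x _ => mul_le_of_le_one_left (jointProb_pos φ x).le (hf x).2

/-- If `X_i` and `X_j` are dependent under `ψ`, they are so for all distributions close to it. -/
theorem eventually_expect_mul_ne {ψ : Param d} (hψ : Acyclic ψ) {i j : Fin p}
    (hdep : ¬ IndepFun (fun x : State d => x i) (fun x : State d => x j) (jointLaw ψ)) :
    ∀ᶠ ε : ℝ in 𝓝[>] 0, ∀ φ : Param d, Acyclic φ →
      (∀ x, |Real.log (jointProb φ x) - Real.log (jointProb ψ x)| ≤ ε) →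
      ∃ (u : Fin (d i + 1) → ℝ) (v : Fin (d j + 1) → ℝ),
        expect φ (fun x => u (x i) * v (x j))
        ≠ expect φ (fun x => u (x i)) * expect φ (fun x => v (x j)) := by
  have h := mt indepFun_of_expect_mul hdep
  push Not at h
  obtain ⟨u, v, hu, hv, hne⟩ := h
  set η := |expect ψ (fun x => u (x i) * v (x j))
    - expect ψ (fun x => u (x i)) * expect ψ (fun x => v (x j))| with hη
  have hη0 : 0 < η := abs_pos.2 (sub_ne_zero.2 hne)
  -- The covariance involves three expectations, each moving by at most card * (exp ε - 1); the gap
  -- η survives while three times this is below η.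
  have hlim : Tendsto (fun ε : ℝ => 3 * (Fintype.card (State d) * (Real.exp ε - 1)))
      (𝓝[>] 0) (𝓝 0) := by
    have : Continuous (fun ε : ℝ => 3 * (Fintype.card (State d) * (Real.exp ε - 1))) := by fun_prop
    simpa using (this.tendsto 0).mono_left nhdsWithin_le_nhds
  filter_upwards [hlim.eventually_lt_const hη0] with ε hε φ hφ hclose
  refine ⟨u, v, fun heq => ?_⟩
  set t := Fintype.card (State d) * (Real.exp ε - 1)
  have huv : ∀ x : State d, u (x i) * v (x j) ∈ Set.Icc (0 : ℝ) 1 := fun x =>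
    ⟨mul_nonneg (hu _).1 (hv _).1, mul_le_one₀ (hu _).2 (hv _).1 (hv _).2⟩
  have h1 := abs_expect_sub_le hclose huv
  have h2 := abs_expect_sub_le hclose (f := fun x => u (x i)) fun x => hu _
  have h3 := abs_expect_sub_le hclose (f := fun x => v (x j)) fun x => hv _
  have b2 := expect_mem_Icc hφ (f := fun x => u (x i)) fun x => hu _
  have b3 := expect_mem_Icc hψ (f := fun x => v (x j)) fun x => hv _
  rw [heq] at h1
  set a := expect φ (fun x => u (x i))
  set b := expect φ (fun x => v (x j))
  set a' := expect ψ (fun x => u (x i))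
  set b' := expect ψ (fun x => v (x j))
  have h4 : |a * (b - b')| ≤ t := by
    rw [abs_mul, abs_of_nonneg b2.1]
    exact (mul_le_of_le_one_left (abs_nonneg _) b2.2).trans h3
  have h5 : |(a - a') * b'| ≤ t := by
    rw [abs_mul, abs_of_nonneg b3.1]
    exact (mul_le_of_le_one_right (abs_nonneg _) b3.2).trans h2
  have : η ≤ 3 * t := by
    rw [hη, abs_le]
    rw [abs_le] at h1 h4 h5
    constructor <;> linarith [h1.1, h1.2, h4.1, h4.2, h5.1, h5.2]
  linarith

/-- Identifiability with a linear rate: the distance of `φ` to a natural parameter is controlled by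
the log-likelihood ratios under the interventions. -/
theorem IsNatural.exists_norm_sub_le {ψ : Param d} (hnat : IsNatural ψ) (hψ : ψ ∈ paramSpace d)
    (i₀ : Fin p) : ∃ C : ℝ, 0 < C ∧ ∀ φ ∈ paramSpace d, ∀ ε : ℝ,
      (∀ k x, |logRatio φ ψ k x| ≤ ε) → ‖φ - ψ‖ ≤ C * ε := by
  have hgap : ∀ᶠ c : ℝ in 𝓝[>] 0, ∀ i s : Fin p, Edge ψ i s → ∀ φ : Param d, Acyclic φ →
      (∀ x, |Real.log (jointProb φ x) - Real.log (jointProb (intervene i ψ) x)| ≤ c) →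
      ∃ (u : Fin (d i + 1) → ℝ) (v : Fin (d s + 1) → ℝ),
        expect φ (fun x => u (x i) * v (x s))
          ≠ expect φ (fun x => u (x i)) * expect φ (fun x => v (x s)) := by
    rw [eventually_all]
    intro i
    rw [eventually_all]
    intro s
    by_cases h : Edge ψ i s
    · filter_upwards [eventually_expect_mul_ne (hψ.1.intervene i)
        (hnat i s (Relation.TransGen.single h))] with c hc _ using hc
    · simp [h]
  obtain ⟨c, hgap, hc⟩ := (hgap.and self_mem_nhdsWithin).exists
  have hc : 0 < c := hc
  set M : ℝ := Fintype.card (Idx d) * 4 with hM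
  have hM0 : 0 ≤ M := by positivity
  set Q : ℝ := ∑ k, ∑ x : State d, -Real.log (jointProb (intervene k ψ) x) with hQ
  have hneg : ∀ k (x : State d), 0 ≤ -Real.log (jointProb (intervene k ψ) x) := fun k x =>
    neg_nonneg.2 (Real.log_nonpos (jointProb_pos _ x).le (jointProb_le_one _ x))
  have hQle : ∀ k (x : State d), -Real.log (jointProb (intervene k ψ) x) ≤ Q := fun k x =>
    (Finset.single_le_sum (fun y _ => hneg k y) (Finset.mem_univ x)).trans
      (Finset.single_le_sum (f := fun k => ∑ x : State d, -Real.log (jointProb (intervene k ψ) x))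
        (fun k _ => Finset.sum_nonneg fun y _ => hneg k y) (Finset.mem_univ k))
  have hQ0 : 0 ≤ Q := (hneg i₀ 0).trans (hQle i₀ 0)
  -- Once c ≤ ε, this turns the constant M * Q + ‖ψ‖ into a multiple of ε.
  set C₂ : ℝ := (M * Q + ‖ψ‖) / c with hC₂
  have hC₂0 : 0 ≤ C₂ := by positivity
  refine ⟨M * (4 * p + 6) + (M + C₂) + 1, by positivity, fun φ hφ ε h => ?_⟩
  have hε : 0 ≤ ε := (abs_nonneg _).trans (h i₀ 0)
  obtain ⟨s, hs⟩ := hφ.1.exists_source i₀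
  by_cases hs' : ∀ i, ¬ Edge ψ i s
  · refine (norm_sub_le_of_common_source hφ hψ hs hs' h).trans ?_
    have : 0 ≤ (M + C₂ + 1) * ε := by positivity
    rw [hM] at this ⊢
    linarith
  · push Not at hs'
    obtain ⟨i, hi⟩ := hs'
    have his : i ≠ s := by
      rintro rfl
      exact hψ.1.not_edge_self i hi
    -- If ε < c, then X_i and X_s would be dependent under φ_[i], where both are sources.
    have hcε : c ≤ ε := by
      by_contra! hlt
      obtain ⟨u, v, huv⟩ := hgap i s hi (intervene i φ) (hφ.1.intervene i)
        fun x => (h i x).trans hlt.le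
      exact huv ((hφ.1.intervene i).expect_mul_of_sources his
        (fun k hk => hk.of_intervene.1 rfl) (fun k hk => hs k hk.of_intervene.2) u v)
    have h1 : ‖φ‖ ≤ Fintype.card (Idx d) * (4 * (Q + ε)) := by
      refine norm_le_of_neg_log_jointProb_le hφ (by positivity) fun k x => ?_
      have h2 := (abs_le.1 (h k x)).1
      rw [logRatio] at h2
      linarith [hQle k x]
    have h2 : M * Q + ‖ψ‖ ≤ C₂ * ε := by
      rw [hC₂, div_mul_eq_mul_div, le_div_iff₀ hc]
      exact mul_le_mul_of_nonneg_left hcε (by positivity)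
    have h3 : 0 ≤ M * (4 * p + 6) * ε := by positivity
    have h4 := norm_sub_le φ ψ
    rw [hM] at h2 h3 ⊢
    linarith

/-! ### The Kullback–Leibler divergence -/

theorem abs_mul_min_le_exp_sub (h : ℝ) : |h| * min |h| 1 / 16 ≤ Real.exp h - 1 - h := by
  have hm : |h| * min |h| 1 ≤ |h| * |h| :=
    mul_le_mul_of_nonneg_left (min_le_left _ _) (abs_nonneg h)
  have hm' : |h| * min |h| 1 ≤ |h| := mul_le_of_le_one_right (abs_nonneg h) (min_le_right _ _)
  rw [abs_mul_abs_self] at hm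
  rcases le_total 0 h with h0 | h0
  · have := Real.quadratic_le_exp_of_nonneg h0
    nlinarith
  · rcases le_total (-2) h with h2 | h2
    · have e1 : Real.exp h = Real.exp (h / 2) * Real.exp (h / 2) := by
        rw [← Real.exp_add]
        ring_nf
      have e2 := Real.add_one_le_exp (h / 2)
      have e3 : Real.exp (h / 2) * Real.exp (-(h / 2)) = 1 := by
        rw [← Real.exp_add]
        simp
      have e4 := Real.add_one_le_exp (-(h / 2))
      -- With y = exp (h / 2), exp h - 1 - h = (1 - y)² + 2 (y - 1 - h / 2) ≥ (1 - y)² ≥ (h / 4)²: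
      -- the source of the 16.
      have e5 : Real.exp (h / 2) ≤ 1 + h / 4 := by
        have := mul_le_mul_of_nonneg_left e4 (Real.exp_pos (h / 2)).le
        rw [e3] at this
        nlinarith
      nlinarith [Real.exp_pos (h / 2)]
    · rw [abs_of_nonpos h0] at hm' ⊢
      linarith [Real.exp_pos h]

/-- Both laws have total mass one, so the mean of h under q is -∑ q (exp h - 1 - h). All summands
are nonnegative, and the one at x is kept. -/
theorem expect_logRatio_le {φ ψ : Param d} (hφ : Acyclic φ) (hψ : Acyclic ψ) (k : Fin p)
    (x : State d) : expect (intervene k ψ) (logRatio φ ψ k)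
      ≤ -(jointProb (intervene k ψ) x * (|logRatio φ ψ k x| * min |logRatio φ ψ k x| 1 / 16)) := by
  set q := jointProb (intervene k ψ) with hq
  set h := logRatio φ ψ k with hh
  have h1 : ∀ y, q y * Real.exp (h y) = jointProb (intervene k φ) y := fun y => by
    rw [hh, logRatio, Real.exp_sub, Real.exp_log (jointProb_pos _ _),
      Real.exp_log (jointProb_pos _ _)]
    exact mul_div_cancel₀ _ (jointProb_pos _ _).ne'
  have h2 : expect (intervene k ψ) h = -∑ y, q y * (Real.exp (h y) - 1 - h y) := by
    have h3 : ∑ y, q y = 1 := (hψ.intervene k).sum_jointProb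
    simp only [mul_sub, h1, Finset.sum_sub_distrib, mul_one, (hφ.intervene k).sum_jointProb, h3,
      expect, ← hq, mul_comm (h _)]
    ring
  rw [h2, neg_le_neg_iff]
  have hq0 : ∀ y, 0 < q y := jointProb_pos _
  refine (mul_le_mul_of_nonneg_left (abs_mul_min_le_exp_sub (h x)) (hq0 x).le).trans ?_
  refine Finset.single_le_sum (f := fun y => q y * (Real.exp (h y) - 1 - h y))
    (fun y _ => mul_nonneg (hq0 y).le ?_) (Finset.mem_univ x)
  linarith [Real.add_one_le_exp (h y)]

/-! ### The parameter space is closed and the criterion is continuous -/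

theorem continuous_coef (j i : Fin p) (l : Fin (d j + 1)) (m : Fin (d i)) :
    Continuous fun φ : Param d => coef φ j i l m := by
  unfold coef
  fun_prop

theorem continuous_intercept (j : Fin p) (l : Fin (d j + 1)) :
    Continuous fun φ : Param d => intercept φ j l := by
  unfold intercept
  fun_prop

theorem continuous_group (j i : Fin p) : Continuous fun φ : Param d => group φ j i := by
  unfold group
  refine (PiLp.continuous_toLp 2 _).comp (continuous_pi fun q => continuous_coef _ _ _ _)

/-- Nonzero groups remain nonzero nearby, so a small perturbation cannot destroy a cycle. -/
theorem isClosed_setOf_acyclic : IsClosed {φ : Param d | Acyclic φ} := by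
  rw [← isOpen_compl_iff, isOpen_iff_mem_nhds]
  intro φ hφ
  have hE : ∀ᶠ ψ in 𝓝 φ, ∀ i j, Edge φ i j → Edge ψ i j := by
    rw [eventually_all]
    intro i
    rw [eventually_all]
    intro j
    by_cases h : Edge φ i j
    · filter_upwards [(continuous_group j i).continuousAt.eventually_ne h] with ψ hψ _ using hψ
    · simp [h]
  filter_upwards [hE] with ψ hψ hac
  exact hφ (hac.mono hψ)

variable (d) in
theorem isClosed_paramSpace : IsClosed (paramSpace d) := by
  have h1 : IsClosed {φ : Param d | ∀ j, intercept φ j 0 = 0} := by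
    simp only [Set.ofPred_forall]
    exact isClosed_iInter fun j => isClosed_eq (continuous_intercept j 0) continuous_const
  have h2 : IsClosed {φ : Param d | ∀ (j i : Fin p) (m : Fin (d i)), ∑ l, coef φ j i l m = 0} := by
    simp only [Set.ofPred_forall]
    exact isClosed_iInter fun j => isClosed_iInter fun i => isClosed_iInter fun m =>
      isClosed_eq (continuous_finsetSum _ fun l _ => continuous_coef j i l m) continuous_const
  exact isClosed_setOf_acyclic.inter (h1.inter h2)

theorem continuous_linPred (j : Fin p) (l : Fin (d j + 1)) (x : State d) :
    Continuous fun φ : Param d => linPred φ j l x :=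
  (continuous_intercept j l).add <| continuous_finsetSum _ fun i _ =>
    continuous_finsetSum _ fun m _ => continuous_const.mul (continuous_coef j i l m)

theorem continuous_jointProb (x : State d) : Continuous fun φ : Param d => jointProb φ x :=
  continuous_finsetProd _ fun j _ =>
    (Real.continuous_exp.comp (continuous_linPred j (x j) x)).div
      (continuous_finsetSum _ fun m _ => Real.continuous_exp.comp (continuous_linPred j m x))
      fun φ => (sum_exp_linPred_pos φ j x).ne'

theorem continuous_intervene (k : Fin p) : Continuous fun φ : Param d => intervene k φ := by
  unfold intervene
  refine (PiLp.continuous_toLp 2 _).comp (continuous_pi fun q => ?_)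
  split_ifs <;> fun_prop

theorem continuous_penLogLik {N : Fin p → ℕ} (data : ∀ k : Fin p, Fin (N k) → State d) (lam : ℝ)
    (τ : Fin p → Fin p → ℝ) : Continuous (penLogLik data lam τ) := by
  refine Continuous.sub ?_ ?_
  · exact continuous_finsetSum _ fun k _ => continuous_finsetSum _ fun h _ =>
      ((continuous_jointProb _).comp (continuous_intervene k)).log
        fun φ => (jointProb_pos _ _).ne'
  · exact continuous_const.mul <| continuous_finsetSum _ fun j _ => continuous_finsetSum _
      fun i _ => continuous_const.mul (continuous_group j i).norm

/-! ### Maximizers for data with nearly correct frequencies -/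

/-- The number of rows of the block `k` that are in the state `x`. -/
noncomputable def count {N : Fin p → ℕ} (data : ∀ k : Fin p, Fin (N k) → State d) (k : Fin p)
    (x : State d) : ℝ :=
  ∑ h : Fin (N k), if data k h = x then 1 else 0

theorem logLik_eq_sum_count {N : Fin p → ℕ} (data : ∀ k : Fin p, Fin (N k) → State d)
    (φ : Param d) :
    logLik data φ = ∑ k, ∑ x, count data k x * Real.log (jointProb (intervene k φ) x) := by
  refine Finset.sum_congr rfl fun k _ => ?_
  simp only [count, Finset.sum_mul]
  rw [Finset.sum_comm]
  exact Finset.sum_congr rfl fun h _ => by simp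

/-- Drift (minus the weighted Kullback–Leibler divergences) plus fluctuation, which is linear in the
log-ratios. -/
theorem logLik_sub_logLik {N : Fin p → ℕ} (data : ∀ k : Fin p, Fin (N k) → State d)
    (φ ψ : Param d) : logLik data φ - logLik data ψ
      = ∑ k, N k * expect (intervene k ψ) (logRatio φ ψ k)
        + ∑ k, ∑ x, (count data k x - N k * jointProb (intervene k ψ) x) * logRatio φ ψ k x := by
  rw [logLik_eq_sum_count, logLik_eq_sum_count, ← Finset.sum_sub_distrib,
    ← Finset.sum_add_distrib]
  refine Finset.sum_congr rfl fun k _ => ?_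
  rw [expect, Finset.mul_sum, ← Finset.sum_sub_distrib, ← Finset.sum_add_distrib]
  refine Finset.sum_congr rfl fun x _ => ?_
  rw [logRatio]
  ring

section Deterministic

variable {ψ : Param d} {C q m B : ℝ} {N : Fin p → ℕ} {data : ∀ k : Fin p, Fin (N k) → State d}
  {lam : ℝ} {τ : Fin p → Fin p → ℝ}

/-- The block and state attaining the largest log-ratio ε already supply the negative drift.
Fluctuation and penalty are at most linear in ε, the latter because group norms are Lipschitz and ‖φ
- ψ‖ ≤ C ε. -/
theorem exists_penLogLik_sub_le (i₀ : Fin p) (hψ : ψ ∈ paramSpace d)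
    (hC : ∀ φ ∈ paramSpace d, ∀ ε : ℝ, (∀ k x, |logRatio φ ψ k x| ≤ ε) → ‖φ - ψ‖ ≤ C * ε)
    (hq0 : 0 ≤ q) (hq : ∀ k x, q ≤ jointProb (intervene k ψ) x) (hm : ∀ k, m ≤ N k)
    (hcount : ∀ k x, |count data k x - N k * jointProb (intervene k ψ) x| ≤ B)
    (hτ : ∀ j i, |lam * τ j i| ≤ B) {φ : Param d} (hφ : φ ∈ paramSpace d) :
    ∃ ε : ℝ, 0 ≤ ε ∧ ‖φ - ψ‖ ≤ C * ε ∧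
      penLogLik data lam τ φ - penLogLik data lam τ ψ
        ≤ -(m * q / 16) * (ε * min ε 1)
          + B * (p * Fintype.card (State d) + p * p * C) * ε := by
  have : Nonempty (Fin p) := ⟨i₀⟩
  have hB : 0 ≤ B := (abs_nonneg _).trans (hτ i₀ i₀)
  obtain ⟨⟨k₀, x₀⟩, hmax⟩ :=
    Finite.exists_max fun z : Fin p × State d => |logRatio φ ψ z.1 z.2|
  set ε := |logRatio φ ψ k₀ x₀| with hεdef
  have hε : 0 ≤ ε := abs_nonneg _
  have hle : ∀ k x, |logRatio φ ψ k x| ≤ ε := fun k x => hmax (k, x)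
  have hdist := hC φ hφ ε hle
  refine ⟨ε, hε, hdist, ?_⟩
  have hεm : 0 ≤ ε * min ε 1 := mul_nonneg hε (le_min hε zero_le_one)
  have hkl : ∑ k, N k * expect (intervene k ψ) (logRatio φ ψ k)
      ≤ -(m * q / 16) * (ε * min ε 1) := by
    rw [← Finset.add_sum_erase _ _ (Finset.mem_univ k₀)]
    have h1 : ∑ k ∈ Finset.univ.erase k₀, N k * expect (intervene k ψ) (logRatio φ ψ k) ≤ 0 := by
      refine Finset.sum_nonpos fun k _ => mul_nonpos_of_nonneg_of_nonpos (Nat.cast_nonneg _) ?_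
      refine (expect_logRatio_le hφ.1 hψ.1 k 0).trans (neg_nonpos.2 ?_)
      exact mul_nonneg (jointProb_pos _ _).le (div_nonneg (mul_nonneg (abs_nonneg _)
        (le_min (abs_nonneg _) zero_le_one)) (by norm_num))
    have h2 := expect_logRatio_le hφ.1 hψ.1 k₀ x₀
    rw [← hεdef] at h2
    have h3 : N k₀ * expect (intervene k₀ ψ) (logRatio φ ψ k₀)
        ≤ N k₀ * -(q * (ε * min ε 1 / 16)) := by
      refine mul_le_mul_of_nonneg_left (h2.trans (neg_le_neg ?_)) (Nat.cast_nonneg _)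
      exact mul_le_mul_of_nonneg_right (hq k₀ x₀) (by positivity)
    have h4 : m * (q * (ε * min ε 1 / 16)) ≤ N k₀ * (q * (ε * min ε 1 / 16)) :=
      mul_le_mul_of_nonneg_right (hm k₀) (by positivity)
    linarith
  have hfluct : ∑ k, ∑ x, (count data k x - N k * jointProb (intervene k ψ) x) * logRatio φ ψ k x
      ≤ p * (Fintype.card (State d) * (B * ε)) := by
    refine (Finset.sum_le_card_nsmul _ _ (Fintype.card (State d) * (B * ε)) fun k _ => ?_).trans
      (by simp)
    refine (Finset.sum_le_card_nsmul _ _ (B * ε) fun x _ => ?_).trans (by simp)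
    refine (le_abs_self _).trans ?_
    rw [abs_mul]
    exact mul_le_mul (hcount k x) (hle k x) (abs_nonneg _) hB
  have hpen : -(lam * ∑ j, ∑ i, τ j i * ‖group φ j i‖) + lam * ∑ j, ∑ i, τ j i * ‖group ψ j i‖
      ≤ p * (p * (B * (C * ε))) := by
    have h1 : -(lam * ∑ j, ∑ i, τ j i * ‖group φ j i‖) + lam * ∑ j, ∑ i, τ j i * ‖group ψ j i‖
        = ∑ j, ∑ i, (lam * τ j i) * (‖group ψ j i‖ - ‖group φ j i‖) := by
      simp only [mul_sub, Finset.sum_sub_distrib, Finset.mul_sum, mul_assoc]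
      ring
    rw [h1]
    refine (Finset.sum_le_card_nsmul _ _ (p * (B * (C * ε))) fun j _ => ?_).trans (by simp)
    refine (Finset.sum_le_card_nsmul _ _ (B * (C * ε)) fun i _ => ?_).trans (by simp)
    refine (le_abs_self _).trans ?_
    rw [abs_mul]
    refine mul_le_mul (hτ j i) ?_ (abs_nonneg _) hB
    refine (abs_norm_sub_norm_le _ _).trans ?_
    rw [← group_sub]
    refine (norm_group_le _ _ _).trans ?_
    rwa [norm_sub_rev]
  have := logLik_sub_logLik data φ ψ
  unfold penLogLik
  linarith

theorem norm_sub_le_of_penLogLik_le (i₀ : Fin p) (hψ : ψ ∈ paramSpace d) (hC0 : 0 ≤ C)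
    (hC : ∀ φ ∈ paramSpace d, ∀ ε : ℝ, (∀ k x, |logRatio φ ψ k x| ≤ ε) → ‖φ - ψ‖ ≤ C * ε)
    (hq0 : 0 ≤ q) (hq : ∀ k x, q ≤ jointProb (intervene k ψ) x) (hm : ∀ k, m ≤ N k)
    (hcount : ∀ k x, |count data k x - N k * jointProb (intervene k ψ) x| ≤ B)
    (hτ : ∀ j i, |lam * τ j i| ≤ B)
    (hsmall : B * (p * Fintype.card (State d) + p * p * C) < m * q / 16) {φ : Param d}
    (hφ : φ ∈ paramSpace d) (hle : penLogLik data lam τ ψ ≤ penLogLik data lam τ φ) :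
    ‖φ - ψ‖ ≤ C * (B * (p * Fintype.card (State d) + p * p * C) / (m * q / 16)) := by
  obtain ⟨ε, hε, hdist, hbound⟩ :=
    exists_penLogLik_sub_le i₀ hψ hC hq0 hq hm hcount hτ hφ
  have hB : 0 ≤ B := (abs_nonneg _).trans (hτ i₀ i₀)
  refine hdist.trans (mul_le_mul_of_nonneg_left ?_ hC0)
  set K := B * (p * Fintype.card (State d) + p * p * C) with hK
  set w := m * q / 16
  have hK0 : 0 ≤ K := by positivity
  have hw : 0 < w := hK0.trans_lt hsmall
  rw [le_div_iff₀ hw]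
  rcases hε.eq_or_lt with rfl | hε
  · simpa using hK0
  · have h1 : w * min ε 1 ≤ K := by
      have h2 : (w * min ε 1) * ε ≤ K * ε := by linarith
      exact le_of_mul_le_mul_right h2 hε
    -- For ε ≥ 1 the bound reads w ≤ K, against `hsmall`.
    rcases le_total ε 1 with h | h
    · rw [min_eq_left h] at h1
      linarith
    · rw [min_eq_right h] at h1
      linarith

/-- Parameters at least as good as ψ lie in a closed ball about ψ, so a maximum over its compact
intersection with the parameter space is global. -/
theorem exists_isGlobalMaximizer (i₀ : Fin p) (hψ : ψ ∈ paramSpace d) (hC0 : 0 ≤ C)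
    (hC : ∀ φ ∈ paramSpace d, ∀ ε : ℝ, (∀ k x, |logRatio φ ψ k x| ≤ ε) → ‖φ - ψ‖ ≤ C * ε)
    (hq0 : 0 ≤ q) (hq : ∀ k x, q ≤ jointProb (intervene k ψ) x) (hm : ∀ k, m ≤ N k)
    (hcount : ∀ k x, |count data k x - N k * jointProb (intervene k ψ) x| ≤ B)
    (hτ : ∀ j i, |lam * τ j i| ≤ B)
    (hsmall : B * (p * Fintype.card (State d) + p * p * C) < m * q / 16) :
    ∃ φ, IsGlobalMaximizer (penLogLik data lam τ) φ := by
  set r := C * (B * (p * Fintype.card (State d) + p * p * C) / (m * q / 16)) with hr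
  have hB : 0 ≤ B := (abs_nonneg _).trans (hτ i₀ i₀)
  have hK0 : 0 ≤ B * (p * Fintype.card (State d) + p * p * C) := by positivity
  have hr0 : 0 ≤ r := mul_nonneg hC0 (div_nonneg hK0 (hK0.trans hsmall.le))
  have hψr : ψ ∈ paramSpace d ∩ Metric.closedBall ψ r := ⟨hψ, Metric.mem_closedBall_self hr0⟩
  obtain ⟨φ, hφ, hmax⟩ := ((isCompact_closedBall ψ r).inter_left
    (isClosed_paramSpace d)).exists_isMaxOn ⟨ψ, hψr⟩ (continuous_penLogLik data lam τ).continuousOn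
  refine ⟨φ, hφ.1, fun φ' hφ' => ?_⟩
  rcases le_total (penLogLik data lam τ ψ) (penLogLik data lam τ φ') with h | h
  · refine hmax ⟨hφ', ?_⟩
    rw [Metric.mem_closedBall, dist_eq_norm]
    exact norm_sub_le_of_penLogLik_le i₀ hψ hC0 hC hq0 hq hm hcount hτ hsmall hφ' h
  · exact h.trans (hmax hψr)

end Deterministic

variable {S : Type*} [MeasurableSpace S] {μ : Measure S}

/-! ### Stochastic bounds -/

theorem jointLaw_real_singleton {φ : Param d} (x : State d) :
    (jointLaw φ).real {x} = jointProb φ x := by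
  have : expect φ (({x} : Set (State d)).indicator 1) = jointProb φ x := by
    simp [expect, Set.indicator_apply]
  rw [measureReal_def, jointLaw_apply, this, ENNReal.toReal_ofReal (jointProb_pos φ x).le]

/-- Chebyshev's inequality for the frequency of a state. -/
theorem measure_frequency_deviation_le [IsProbabilityMeasure μ] {φ : Param d}
    {M : ℕ} {Y : Fin M → S → State d} (hlaw : ∀ h, HasLaw (Y h) (jointLaw φ) μ)
    (hind : iIndepFun Y μ) (x : State d) {c : ℝ} (hc : 0 < c) :
    μ {ω | c < |(∑ h, if Y h ω = x then (1 : ℝ) else 0) - M * jointProb φ x|}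
      ≤ ENNReal.ofReal (M / c ^ 2) := by
  set f : State d → ℝ := ({x} : Set (State d)).indicator 1 with hf
  have hfm : Measurable f := measurable_of_countable f
  have hf01 : ∀ y, f y ∈ Set.Icc (0 : ℝ) 1 := fun y =>
    ⟨Set.indicator_nonneg (by simp) y, Set.indicator_le_self' (by simp) y⟩
  have hZm : ∀ h, AEMeasurable (f ∘ Y h) μ := fun h => hfm.comp_aemeasurable (hlaw h).aemeasurable
  have hZ2 : ∀ h, MemLp (f ∘ Y h) 2 μ := fun h =>
    memLp_of_bounded (Eventually.of_forall fun ω => hf01 (Y h ω)) (hZm h).aestronglyMeasurable 2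
  have hmean : ∀ h, ∫ ω, (f ∘ Y h) ω ∂μ = jointProb φ x := fun h => by
    rw [(hlaw h).integral_comp hfm.aestronglyMeasurable, hf,
      integral_indicator_one (measurableSet_singleton x), jointLaw_real_singleton]
  have hvar : Var[∑ h, f ∘ Y h; μ] ≤ M := by
    rw [IndepFun.variance_sum (fun h _ => hZ2 h) fun h _ h' _ hne =>
      (hind.indepFun hne).comp hfm hfm]
    refine (Finset.sum_le_card_nsmul _ _ 1 fun h _ => ?_).trans (by simp)
    refine (variance_le_sq_of_bounded (Eventually.of_forall fun ω => hf01 (Y h ω))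
      (hZm h)).trans (by norm_num)
  have hsum : ∫ ω, (∑ h, f ∘ Y h) ω ∂μ = M * jointProb φ x := by
    simp only [Finset.sum_apply]
    rw [integral_finsetSum _ fun h _ => (hZ2 h).integrable (by norm_num),
      Finset.sum_congr rfl fun h _ => hmean h]
    simp
  have hval : ∀ ω, (∑ h, f ∘ Y h) ω = ∑ h, if Y h ω = x then (1 : ℝ) else 0 := fun ω => by
    simp only [Finset.sum_apply, Function.comp_apply, hf, Set.indicator_apply,
      Set.mem_singleton_iff, Pi.one_apply]
  have hcheb := meas_ge_le_variance_div_sq (memLp_finsetSum' Finset.univ fun h _ => hZ2 h) hc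
  rw [hsum] at hcheb
  refine (measure_mono fun ω hω => ?_).trans
    (hcheb.trans (ENNReal.ofReal_le_ofReal (div_le_div_of_nonneg_right hvar (sq_nonneg c))))
  simp only [Set.mem_ofPred_eq, hval] at hω ⊢
  exact hω.le

theorem IsBigOInProb.of_frequency [IsProbabilityMeasure μ] {φ : Param d}
    {M : ℕ → ℕ} (hM : ∀ n, M n ≤ n) {Y : ∀ n, Fin (M n) → S → State d}
    (hlaw : ∀ n h, HasLaw (Y n h) (jointLaw φ) μ) (hind : ∀ n, iIndepFun (Y n) μ) (x : State d) :
    IsBigOInProb μ (fun n ω => (∑ h, if Y n h ω = x then (1 : ℝ) else 0) - M n * jointProb φ x)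
      fun n => √(n : ℝ) := by
  intro ε hε
  -- Chebyshev at the threshold √(n / ε) gives M n * ε / n ≤ ε.
  refine ⟨(√ε)⁻¹, ?_⟩
  filter_upwards [eventually_gt_atTop 0] with n hn
  have hn' : (0 : ℝ) < n := Nat.cast_pos.2 hn
  have hs := Real.sqrt_pos.2 hε
  refine (measure_frequency_deviation_le (hlaw n) (hind n) x
    (c := (√ε)⁻¹ * √n) (by positivity)).trans (ENNReal.ofReal_le_ofReal ?_)
  rw [mul_pow, inv_pow, Real.sq_sqrt hε.le, Real.sq_sqrt hn'.le, div_le_iff₀ (by positivity)]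
  rw [← mul_assoc, mul_inv_cancel₀ hε.ne', one_mul]
  exact_mod_cast hM n

/-- Finitely many sequences that are bounded in probability are so simultaneously. -/
theorem IsBigOInProb.exists_uniform {κ : Type*} [Fintype κ] {Z : κ → ℕ → S → ℝ} {a : ℕ → ℝ}
    (ha : ∀ n, 0 ≤ a n) (h : ∀ i, IsBigOInProb μ (Z i) a) {ε : ℝ} (hε : 0 < ε) :
    ∃ C : ℝ, ∀ᶠ n in atTop, μ {ω | ∃ i, C * a n < |Z i n ω|} ≤ ENNReal.ofReal ε := by
  have hε' : 0 < ε / (Fintype.card κ + 1) := by positivity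
  choose C hC using fun i => h i _ hε'
  obtain ⟨D, hD⟩ := (Set.finite_range C).bddAbove
  refine ⟨D, ?_⟩
  filter_upwards [eventually_all.2 hC] with n hn
  have hsub : {ω | ∃ i, D * a n < |Z i n ω|} ⊆ ⋃ i, {ω | C i * a n < |Z i n ω|} := by
    rintro ω ⟨i, hi⟩
    exact Set.mem_iUnion.2 ⟨i, (mul_le_mul_of_nonneg_right (hD ⟨i, rfl⟩) (ha n)).trans_lt hi⟩
  refine (measure_mono hsub).trans ((measure_iUnion_fintype_le μ _).trans ?_)
  refine (Finset.sum_le_sum fun i _ => hn i).trans ?_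
  rw [← ENNReal.ofReal_sum_of_nonneg fun _ _ => hε'.le]
  refine ENNReal.ofReal_le_ofReal ?_
  rw [Finset.sum_const, Finset.card_univ, nsmul_eq_mul, ← mul_div_assoc, div_le_iff₀ (by positivity)]
  nlinarith

/-- With probability close to one there is a global maximizer, and all global maximizers are close
to the true parameter. -/
theorem exists_rate [IsProbabilityMeasure μ] {ψ : Param d} (hψ : ψ ∈ paramSpace d)
    (hnat : IsNatural ψ) {N : ℕ → Fin p → ℕ} (hN : ∀ n, ∑ k, N n k = n) {α : Fin p → ℝ}
    (hα : ∀ k, 0 < α k)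
    (hNα : ∀ k, Tendsto (fun n : ℕ => (N n k : ℝ) / (n : ℝ)) atTop (𝓝 (α k)))
    {X : ∀ (n : ℕ) (k : Fin p), Fin (N n k) → S → State d}
    (hlaw : ∀ n k h, HasLaw (X n k h) (jointLaw (intervene k ψ)) μ)
    (hindep : ∀ n k, iIndepFun (X n k) μ) {lam : ℕ → ℝ}
    (hlam : Tendsto (fun n : ℕ => lam n / √(n : ℝ)) atTop (𝓝 0))
    {τ : ℕ → S → Fin p → Fin p → ℝ}
    (hτ : ∀ j i, IsBigOInProb μ (fun n ω => τ n ω j i) (fun _ => 1)) {ε : ℝ} (hε : 0 < ε) :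
    ∃ D : ℝ, ∀ᶠ n : ℕ in atTop, μ {ω | ¬ ((∃ φ, IsGlobalMaximizer
          (penLogLik (fun k h => X n k h ω) (lam n) (τ n ω)) φ) ∧
        ∀ φ, IsGlobalMaximizer (penLogLik (fun k h => X n k h ω) (lam n) (τ n ω)) φ →
          ‖φ - ψ‖ ≤ D * (√(n : ℝ))⁻¹)} ≤ ENNReal.ofReal ε := by
  obtain ⟨i₀⟩ : Nonempty (Fin p) := by
    by_contra h
    rw [not_nonempty_iff] at h
    simpa using hN 1
  obtain ⟨C, hC0, hC⟩ := hnat.exists_norm_sub_le hψ i₀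
  have : Nonempty (Fin p) := ⟨i₀⟩
  obtain ⟨q, hq0, hq⟩ : ∃ q : ℝ, 0 < q ∧ ∀ k x, q ≤ jointProb (intervene k ψ) x := by
    obtain ⟨z, hz⟩ := Finite.exists_min fun z : Fin p × State d => jointProb (intervene z.1 ψ) z.2
    exact ⟨_, jointProb_pos _ _, fun k x => hz (k, x)⟩
  obtain ⟨a, ha0, ha⟩ : ∃ a : ℝ, 0 < a ∧ ∀ k, a < α k := by
    obtain ⟨k₀, hk₀⟩ := Finite.exists_min α
    exact ⟨α k₀ / 2, half_pos (hα k₀), fun k => (half_lt_self (hα k₀)).trans_le (hk₀ k)⟩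
  have hNn : ∀ n k, N n k ≤ n := fun n k => by
    conv_rhs => rw [← hN n]
    exact Finset.single_le_sum (fun _ _ => Nat.zero_le _) (Finset.mem_univ k)
  obtain ⟨b, hb⟩ := IsBigOInProb.exists_uniform (κ := Fin p × State d)
    (Z := fun z n ω => (∑ h, if X n z.1 h ω = z.2 then (1 : ℝ) else 0)
      - N n z.1 * jointProb (intervene z.1 ψ) z.2) (a := fun n => √(n : ℝ))
    (fun n => Real.sqrt_nonneg _)
    (fun z => IsBigOInProb.of_frequency (fun n => hNn n z.1) (fun n => hlaw n z.1)
      (fun n => hindep n z.1) z.2) (half_pos hε)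
  obtain ⟨T, hT⟩ := IsBigOInProb.exists_uniform (κ := Fin p × Fin p)
    (Z := fun z n ω => τ n ω z.1 z.2) (a := fun _ => 1) (fun _ => zero_le_one)
    (fun z => hτ z.1 z.2) (half_pos hε)
  set E := max b T with hE
  set K : ℝ := p * Fintype.card (State d) + p * p * C with hK
  -- The deterministic radius for B = E √n and m = a n, with the factor n^{-1/2} split off; `hsqrt`
  -- below yields the smallness condition.
  refine ⟨C * (E * K / (a * q / 16)), ?_⟩
  have haq : 0 < a * q / 16 := by positivity
  have hNa : ∀ᶠ n : ℕ in atTop, ∀ k, a < (N n k : ℝ) / n :=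
    eventually_all.2 fun k => (hNα k).eventually_const_lt (ha k)
  have hlam1 : ∀ᶠ n : ℕ in atTop, |lam n / √(n : ℝ)| < 1 := by
    have := hlam.abs
    rw [abs_zero] at this
    exact this.eventually_lt_const one_pos
  have hsqrt : ∀ᶠ n : ℕ in atTop, E * K / (a * q / 16) < √(n : ℝ) :=
    (Real.tendsto_sqrt_atTop.comp tendsto_natCast_atTop_atTop).eventually_gt_atTop _
  filter_upwards [hb, hT, hNa, hlam1, hsqrt, eventually_gt_atTop 0] with n hb hT hNa hlam1 hsqrt hn
  have hn' : (0 : ℝ) < n := Nat.cast_pos.2 hn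
  have hs : 0 < √(n : ℝ) := Real.sqrt_pos.2 hn'
  have hss : √(n : ℝ) * √(n : ℝ) = n := Real.mul_self_sqrt hn'.le
  have hlamn : |lam n| ≤ √(n : ℝ) := by
    rw [abs_div, abs_of_pos hs, div_lt_one hs] at hlam1
    exact hlam1.le
  refine (measure_mono (t := {ω | ∃ z : Fin p × State d, b * √(n : ℝ)
      < |(∑ h, if X n z.1 h ω = z.2 then (1 : ℝ) else 0)
        - N n z.1 * jointProb (intervene z.1 ψ) z.2|}
      ∪ {ω | ∃ z : Fin p × Fin p, T * 1 < |τ n ω z.1 z.2|}) ?_).trans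
    ((measure_union_le _ _).trans ((add_le_add hb hT).trans ?_))
  swap
  · rw [← ENNReal.ofReal_add (half_pos hε).le (half_pos hε).le, add_halves]
  intro ω
  contrapose
  intro hω
  simp only [Set.mem_union, Set.mem_ofPred_eq, not_or, not_exists, not_lt, mul_one, Prod.forall]
    at hω
  simp only [Set.mem_ofPred_eq, not_not]
  have hm : ∀ k, a * n ≤ N n k := fun k => ((lt_div_iff₀ hn').1 (hNa k)).le
  have hcount : ∀ k x, |count (fun k h => X n k h ω) k x
      - N n k * jointProb (intervene k ψ) x| ≤ E * √(n : ℝ) := fun k x =>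
    (hω.1 k x).trans (mul_le_mul_of_nonneg_right (le_max_left _ _) hs.le)
  have hpen : ∀ j i, |lam n * τ n ω j i| ≤ E * √(n : ℝ) := fun j i => by
    rw [abs_mul, mul_comm]
    exact mul_le_mul ((hω.2 j i).trans (le_max_right _ _)) hlamn (abs_nonneg _)
      ((abs_nonneg _).trans ((hω.2 j i).trans (le_max_right _ _)))
  have hsmall : E * √(n : ℝ) * K < a * n * q / 16 := by
    rw [div_lt_iff₀ haq] at hsqrt
    calc E * √(n : ℝ) * K = E * K * √(n : ℝ) := by ring
      _ < √(n : ℝ) * (a * q / 16) * √(n : ℝ) := mul_lt_mul_of_pos_right hsqrt hs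
      _ = a * (√(n : ℝ) * √(n : ℝ)) * q / 16 := by ring
      _ = a * n * q / 16 := by rw [hss]
  have hrate : E * √(n : ℝ) * K / (a * n * q / 16) = E * K / (a * q / 16) * (√(n : ℝ))⁻¹ := by
    have h1 : a * n * q / 16 = a * q / 16 * (√(n : ℝ) * √(n : ℝ)) := by
      rw [hss]
      ring
    rw [h1]
    field_simp
  refine ⟨exists_isGlobalMaximizer i₀ hψ hC0.le hC hq0.le hq hm hcount hpen hsmall,
    fun φ hφ => ?_⟩
  have := norm_sub_le_of_penLogLik_le i₀ hψ hC0.le hC hq0.le hq hm hcount hpen hsmall hφ.1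
    (hφ.2 hψ)
  rwa [hrate, ← mul_assoc] at this

end DiscreteBN

open DiscreteBN in
theorem theorem2 {p : ℕ} (d : Fin p → ℕ)
    {S : Type*} [MeasurableSpace S] (μ : Measure S) [IsProbabilityMeasure μ]
    -- the true parameter
    (φs : Param d) (hφs : φs ∈ paramSpace d) (hnat : IsNatural φs)
    -- block sizes: `N n k` is the number `n_k` of rows of the block in which `X_k` is fixed
    (N : ℕ → Fin p → ℕ) (hN : ∀ n, ∑ k, N n k = n)
    (α : Fin p → ℝ) (hα : ∀ k, 0 < α k)
    (hNα : ∀ k, Tendsto (fun n : ℕ => (N n k : ℝ) / (n : ℝ)) atTop (𝓝 (α k)))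
    -- the data: the `k`-th block is an i.i.d. sample from `p(· | φs_[k])`
    (X : ∀ (n : ℕ) (k : Fin p), Fin (N n k) → S → State d)
    (hlaw : ∀ n k h, HasLaw (X n k h) (jointLaw (intervene k φs)) μ)
    (hindep : ∀ n k, iIndepFun (X n k) μ)
    -- tuning parameter and (random) weights
    (lam : ℕ → ℝ)
    (hlam : Tendsto (fun n : ℕ => lam n / √(n : ℝ)) atTop (𝓝 0))
    (τ : ℕ → S → Fin p → Fin p → ℝ)
    (hτ : ∀ j i, IsBigOInProb μ (fun n ω => τ n ω j i) (fun _ => 1)) :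
    ∃ φhat : ℕ → S → Param d,
      (∀ n ω, φhat n ω ∈ paramSpace d) ∧
      -- `φhat` is a global maximizer whenever there is one
      (∀ n ω, (∃ φ, IsGlobalMaximizer
          (penLogLik (fun k h => X n k h ω) (lam n) (τ n ω)) φ) →
        IsGlobalMaximizer (penLogLik (fun k h => X n k h ω) (lam n) (τ n ω)) (φhat n ω)) ∧
      -- which is the case with probability tending to one
      Tendsto (fun n => μ {ω | ¬ IsGlobalMaximizer
          (penLogLik (fun k h => X n k h ω) (lam n) (τ n ω)) (φhat n ω)}) atTop (𝓝 0) ∧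
      IsBigOInProb μ (fun n ω => ‖φhat n ω - φs‖) (fun n => (√(n : ℝ))⁻¹) := by
  classical
  have rate := fun {ε : ℝ} (hε : 0 < ε) =>
    exists_rate hφs hnat hN hα hNα hlaw hindep hlam hτ hε
  -- A pointwise choice is enough: the probability statements are about outer measure, so no
  -- measurable selection is required.
  refine ⟨fun n ω => if h : ∃ φ, IsGlobalMaximizer
      (penLogLik (fun k h => X n k h ω) (lam n) (τ n ω)) φ then h.choose else φs, ?_, ?_, ?_, ?_⟩
  · intro n ω
    dsimp only
    split_ifs with h
    · exact h.choose_spec.1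
    · exact hφs
  · intro n ω h
    dsimp only
    rw [dif_pos h]
    exact h.choose_spec
  · rw [ENNReal.tendsto_nhds_zero]
    intro ε hε
    -- Here ε may be infinite, so a real number below it is used.
    obtain ⟨r, -, hr0, hrε⟩ := ENNReal.lt_iff_exists_real_btwn.1 hε
    obtain ⟨D, hD⟩ := rate (ENNReal.ofReal_pos.1 hr0)
    filter_upwards [hD] with n hn
    refine (measure_mono ?_).trans (hn.trans hrε.le)
    intro ω
    contrapose
    simp only [Set.mem_ofPred_eq, not_not]
    rintro ⟨h, -⟩
    rw [dif_pos h]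
    exact h.choose_spec
  · intro ε hε
    obtain ⟨D, hD⟩ := rate hε
    refine ⟨D, ?_⟩
    filter_upwards [hD] with n hn
    refine (measure_mono ?_).trans hn
    intro ω
    contrapose
    simp only [Set.mem_ofPred_eq, not_not, not_lt]
    rintro ⟨h, hrate⟩
    rw [dif_pos h, abs_norm]
    exact hrate _ h.choose_spec
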